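/- Let $n\ge 1$, let $H$ be a finite abelian group, and let $a_i,b_i,c_i\in\mathbb N$ ($1\le i\le n$) satisfy $a_i\neq 0$ and $(b_i,c_i)\ne(0,0)$ for all $i$, $(b_1,\dots,b_n)\neq 0$ and $(c_1,\dots,c_n)\ne 0$. Let $S\subset\mathbb N^n\oplus H$ be the semigroup (containing $0$) generated by elements $x_i=(a_i\mathbf e_i,h_i)$ ($1\le i\le n$), $z=((b_1,\dots,b_n),h_{n+1})$ and $y=((c_1,\dots,c_n),h_{n+2})$, where $h_1,\dots,h_{n+2}\in H$ are arbitrary; elements of $\mathbb Z^n\oplus H$ are written multiplicatively. Let $S\setminus P_i$ be the set of elements of $S$ whose $i$-th coordinate is $0$, and let $$S'=\bigcap_{i=1}^n\bigl(S-(S\setminus P_i)\bigr)\subset\mathbb Z^n\oplus H .$$ Let $\tilde L\subset\mathbb Z^2$ be the rank two lattice of all $(s,p)$ such that $z^s y^{-p}$ lies in the group generated by $x_1,\dots,x_n$. Let $\varepsilon_{-1}=(s_{-1},0)$, $\varepsilon_0=(s_0,p_0)$ be the basis of $\tilde L$ with $s_{-1},p_0>0$ and $0\le s_0<s_{-1}$.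 As long as $s_{i+1}\ne 0$, put $\varepsilon_{i+2}=(s_{i+2},p_{i+2})=q_{i+2}\varepsilon_{i+1}-\varepsilon_i$ with $q_{i+2}=\lceil s_i/s_{i+1}\rceil$ (so $0\le s_{i+2}<s_{i+1}$), and let $m+1$ be the first index with $s_{m+1}=0$. For $-1\le i\le m+1$ let $\mathbf r_i=(r_{1,i},\dots,r_{n,i})\in\mathbb Z^n$, $r_{j,i}=(s_ib_j-p_ic_j)/a_j$, and let $\mathbf r_{i,+},\mathbf r_{i,-}\in\mathbb N^n$ be its positive and negative parts, $\mathbf r_i=\mathbf r_{i,+}-\mathbf r_{i,-}$. Let $\nu$ be the greatest $i$ with $-1\le i\le m+1$ such that $\mathbf r_i=\mathbf r_{i,+}$, and let $\mu$ be the smallest $i$ with $\nu\le i\le m$ such that $\mathbf r_{i+1}=-\mathbf r_{i+1,-}$. Then for $1\le l\le\mu-\nu$ one has, in $\mathbb Z^n\oplus H$, $$E_l:=\frac{y^{p_{\nu+l}}}{\underline x^{\mathbf r_{\nu+l,-}}}=\frac{z^{s_{\nu+l}}}{\underline x^{\mathbf r_{\nu+l,+}}},$$ and $S'$ is the semigroup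 generated by $S$ and the elements $E_1,\dots,E_{\mu-\nu}$. -/

import Mathlib

noncomputable section

/-- The data of a simplicial semigroup of codimension two, possibly with torsion:
generators `(a i • e i, hx i)`, `(b, hz)` and `(c, hy)` of a subsemigroup of `ℕⁿ ⊕ H`. -/
structure SimplicialData (n : ℕ) (H : Type*) where
  a : Fin n → ℕ
  b : Fin n → ℕ
  c : Fin n → ℕ
  hx : Fin n → H
  hz : H
  hy : H
  a_ne_zero : ∀ i, a i ≠ 0
  bc_ne_zero : ∀ i, b i ≠ 0 ∨ c i ≠ 0
  b_ne_zero : b ≠ 0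
  c_ne_zero : c ≠ 0

namespace SimplicialData

variable {n : ℕ} {H : Type*} [AddCommGroup H] (D : SimplicialData n H)

/-- The degree of the variable `x_i` (monomials are written additively, in `ℤⁿ ⊕ H`). -/
def x (i : Fin n) : (Fin n → ℤ) × H := (Pi.single i (D.a i : ℤ), D.hx i)

/-- The degree of the variable `z`. -/
def z : (Fin n → ℤ) × H := (fun i => (D.b i : ℤ), D.hz)

/-- The degree of the variable `y`. -/
def y : (Fin n → ℤ) × H := (fun i => (D.c i : ℤ), D.hy)

/-- The semigroup `S` (with `0`) generated by the degrees of `x_1, …, x_n, z, y`. -/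
def S : AddSubmonoid ((Fin n → ℤ) × H) :=
  AddSubmonoid.closure (Set.range D.x ∪ {D.z, D.y})

/-- `S - (S \ P_i)`, where `S \ P_i` consists of the elements of `S` with `i`-th coordinate `0`. -/
def localization (i : Fin n) : AddSubmonoid ((Fin n → ℤ) × H) where
  carrier := {g | ∃ u ∈ D.S, ∃ v ∈ D.S, v.1 i = 0 ∧ g = u - v}
  zero_mem' := ⟨0, D.S.zero_mem, 0, D.S.zero_mem, rfl, by simp⟩
  add_mem' := by
    rintro _ _ ⟨u, hu, v, hv, h, rfl⟩ ⟨u', hu', v', hv', h', rfl⟩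
    exact ⟨u + u', D.S.add_mem hu hu', v + v', D.S.add_mem hv hv', by simp [h, h'], by abel⟩

/-- `S' = ⋂ i, (S - (S \ P_i))`. -/
def S' : AddSubmonoid ((Fin n → ℤ) × H) := ⨅ i, D.localization i

/-- The rank two lattice of all `(s, p)` with `s • z - p • y` in the group generated by the
degrees of `x_1, …, x_n`. -/
def Ltilde : AddSubgroup (ℤ × ℤ) where
  carrier := {w | w.1 • D.z - w.2 • D.y ∈ AddSubgroup.closure (Set.range D.x)}
  zero_mem' := by simp
  add_mem' := by
    intro w w' hw hw'
    have h := (AddSubgroup.closure (Set.range D.x)).add_mem hw hw'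
    simp only [Set.mem_ofPred_eq, Prod.fst_add, Prod.snd_add, add_smul]
    convert h using 1
    abel
  neg_mem' := by
    intro w hw
    have h := (AddSubgroup.closure (Set.range D.x)).neg_mem hw
    simp only [Set.mem_ofPred_eq, Prod.fst_neg, Prod.snd_neg, neg_smul]
    convert h using 1
    abel

/-- `s_{-1}`: the least `s > 0` with `(s, 0)` in the lattice. -/
def sInit : ℕ := sInf {s : ℕ | 0 < s ∧ ((s : ℤ), (0 : ℤ)) ∈ D.Ltilde}

/-- `p_0`: the least `p > 0` that is a second coordinate in the lattice. -/
def pZero : ℕ := sInf {p : ℕ | 0 < p ∧ ∃ s : ℤ, (s, (p : ℤ)) ∈ D.Ltilde}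

/-- `s_0`: the least `s ≥ 0` with `(s, p_0)` in the lattice. Thus `(s_{-1}, 0), (s_0, p_0)` is the
basis of the lattice in Hermite normal form, with `0 ≤ s_0 < s_{-1}`. -/
def sZero : ℕ := sInf {s : ℕ | ((s : ℤ), (D.pZero : ℤ)) ∈ D.Ltilde}

/-- The fan vectors, with the index shifted by one: `epsAux k = ε_{k-1}`. The recursion is
`ε_{i+2} = q_{i+2} ε_{i+1} - ε_i` with `q_{i+2} = ⌈s_i / s_{i+1}⌉`, that is, the Euclidean
algorithm `s_i = q_{i+2} s_{i+1} - s_{i+2}` with `0 ≤ s_{i+2} < s_{i+1}`.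
It is meaningful until the first coordinate vanishes. -/
def epsAux : ℕ → ℤ × ℤ
  | 0 => ((D.sInit : ℤ), 0)
  | 1 => ((D.sZero : ℤ), (D.pZero : ℤ))
  | k + 2 =>
    ⌈((epsAux k).1 : ℚ) / ((epsAux (k + 1)).1 : ℚ)⌉ • epsAux (k + 1) - epsAux k

/-- `s_i`, for `i ≥ -1`. -/
def s (i : ℤ) : ℤ := (D.epsAux (i + 1).toNat).1

/-- `p_i`, for `i ≥ -1`. -/
def p (i : ℤ) : ℤ := (D.epsAux (i + 1).toNat).2

/-- The index `m` at which the Euclidean algorithm stops: `m + 1` is the first `i` with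
`s_i = 0`. -/
def m : ℤ := sInf {i : ℤ | -1 ≤ i ∧ D.s (i + 1) = 0}

/-- The vector `r_i`, with coordinates `r_{j,i} = (s_i b_j - p_i c_j) / a_j` (an exact division
for `-1 ≤ i ≤ m + 1`). -/
def r (i : ℤ) (j : Fin n) : ℤ := (D.s i * D.b j - D.p i * D.c j) / D.a j

/-- `ν`: the greatest index `i` such that all the coordinates of `r_i` are nonnegative. -/
def nu : ℤ := sSup {i : ℤ | -1 ≤ i ∧ i ≤ D.m + 1 ∧ ∀ j, 0 ≤ D.r i j}

/-- `μ`: the smallest index `i ≥ ν` such that all the coordinates of `r_{i+1}` are nonpositive. -/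
def mu : ℤ := sInf {i : ℤ | D.nu ≤ i ∧ i ≤ D.m ∧ ∀ j, D.r (i + 1) j ≤ 0}

/-- `y^{p_i} / x^{r_{i,-}}`. -/
def yForm (i : ℤ) : (Fin n → ℤ) × H := D.p i • D.y - ∑ j, (D.r i j)⁻ • D.x j

/-- `z^{s_i} / x^{r_{i,+}}`. -/
def zForm (i : ℤ) : (Fin n → ℤ) × H := D.s i • D.z - ∑ j, (D.r i j)⁺ • D.x j

end SimplicialData

end

/-! Modulo the group generated by the `x_j`, an element `g` is `s • z + p • y`, with `(s, p)`
determined up to the lattice of all `(s, -p)` with `(s, p)` in `Ltilde`. If `g` lies in the `j`-th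
localization, some representative in the first quadrant satisfies `s * b j + p * c j ≤ g.1 j`
(`exists_of_mem_localization`).

Each pair of consecutive fan vectors has an `L`-shaped cell. Its representative minimizes the `j`-th
linear form over the coset in the quadrant, provided `r_j` changes sign between the two vectors
(`InCell.le_of_sub_mem`). This cell depends on `j`, but greedy division by the `s_i` links the
cells: passing to the next one trades `t_i • (s_i, 0)` for `t_i • (0, p_i)` (`InCell.next`).

The element `E_i` accommodates all `j` at once: its `j`-th coordinate is `p_i * c j` where `r_j` is
nonnegative and `s_i * b j` where it is nonpositive. Hence the sum of the `t_i • E_i`, plus the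
remaining multiples of `z` and `y`, has as its `j`-th coordinate exactly the minimum of the `j`-th
form, for every `j`. Subtracting it from `g ∈ S'` leaves an element of the `x`-group with
nonnegative coordinates, which lies in `S` (`exists_sub_sum_mem_S`).

Conversely `E_i ∈ S'`, since for each `j` one of its two fractions has no `x_j` in the denominator
(`yForm_mem_S'`). -/

/-! ### Plane lattices: fan bases and their cells. -/

/-- Two consecutive vectors of the Hirzebruch–Jung fan of a plane lattice: a basis of the lattice
inside the first quadrant, with decreasing first and increasing second coordinates. -/
structure IsFanBasis (L : AddSubgroup (ℤ × ℤ)) (e e' : ℤ × ℤ) : Prop where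
  left_mem : e ∈ L
  right_mem : e' ∈ L
  fst_nonneg : 0 ≤ e'.1
  fst_lt : e'.1 < e.1
  snd_nonneg : 0 ≤ e.2
  snd_lt : e.2 < e'.2
  span : ∀ w ∈ L, ∃ α β : ℤ, w = α • e + β • e'

/-- One step of the Euclidean algorithm with ceilings. -/
theorem IsFanBasis.next {L : AddSubgroup (ℤ × ℤ)} {e e' : ℤ × ℤ} (h : IsFanBasis L e e')
    (hpos : 0 < e'.1) :
    2 ≤ ⌈(e.1 : ℚ) / (e'.1 : ℚ)⌉ ∧ IsFanBasis L e' (⌈(e.1 : ℚ) / (e'.1 : ℚ)⌉ • e' - e) := by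
  have hq : (0 : ℚ) < (e'.1 : ℚ) := by exact_mod_cast hpos
  have hle : e.1 ≤ ⌈(e.1 : ℚ) / (e'.1 : ℚ)⌉ * e'.1 := by
    have := (div_le_iff₀ hq).1 (Int.le_ceil ((e.1 : ℚ) / (e'.1 : ℚ)))
    exact_mod_cast this
  have hlt : (⌈(e.1 : ℚ) / (e'.1 : ℚ)⌉ - 1) * e'.1 < e.1 := by
    have := (lt_div_iff₀ hq).1 (sub_lt_iff_lt_add.2 (Int.ceil_lt_add_one ((e.1 : ℚ) / (e'.1 : ℚ))))
    exact_mod_cast this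
  generalize ⌈(e.1 : ℚ) / (e'.1 : ℚ)⌉ = q at hle hlt ⊢
  have h1 := h.fst_lt
  have h2 := h.snd_lt
  have h3 := h.snd_nonneg
  have hq2 : 2 ≤ q := by
    by_contra hc
    nlinarith
  refine ⟨hq2, h.right_mem, L.sub_mem (L.zsmul_mem h.right_mem q) h.left_mem, ?_, ?_, ?_, ?_, ?_⟩
  · simp only [Prod.fst_sub, Prod.smul_fst, smul_eq_mul]
    linarith
  · simp only [Prod.fst_sub, Prod.smul_fst, smul_eq_mul]
    linarith
  · linarith
  · simp only [Prod.snd_sub, Prod.smul_snd, smul_eq_mul]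
    nlinarith
  · intro w hw
    obtain ⟨α, β, rfl⟩ := h.span w hw
    -- With `e'' = q • e' - e`, substitute `e = q • e' - e''`.
    refine ⟨β + α * q, -α, ?_⟩
    ext <;> simp <;> ring

/-- The `L`-shaped fundamental domain (for the lattice `{(s, -p) | (s, p) ∈ L}`) attached to two
consecutive fan vectors. -/
structure InCell (e e' w : ℤ × ℤ) : Prop where
  fst_nonneg : 0 ≤ w.1
  fst_lt : w.1 < e.1
  snd_nonneg : 0 ≤ w.2
  snd_lt : w.2 < e'.2
  not_corner : ¬ (e.1 - e'.1 ≤ w.1 ∧ e'.2 - e.2 ≤ w.2)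

/-- A point of the cell minimizes all linear forms with coefficients in the dual cone, among the
points of its coset in the first quadrant. -/
theorem InCell.le_of_sub_mem {L : AddSubgroup (ℤ × ℤ)} {e e' w v : ℤ × ℤ}
    (h : IsFanBasis L e e') (hw : InCell e e' w) (hv1 : 0 ≤ v.1) (hv2 : 0 ≤ v.2)
    (hvw : (v.1 - w.1, w.2 - v.2) ∈ L) {b c : ℤ}
    (hr : 0 ≤ e.1 * b - e.2 * c) (hr' : e'.1 * b - e'.2 * c ≤ 0) :
    w.1 * b + w.2 * c ≤ v.1 * b + v.2 * c := by
  obtain ⟨α, β, hαβ⟩ := h.span _ hvw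
  simp only [Prod.ext_iff, Prod.fst_add, Prod.smul_fst, Prod.snd_add, Prod.smul_snd,
    smul_eq_mul] at hαβ
  obtain ⟨h1, h2⟩ := hαβ
  have e1 := h.fst_nonneg
  have e2 := h.fst_lt
  have e3 := h.snd_nonneg
  have e4 := h.snd_lt
  have w2 := hw.fst_lt
  have w4 := hw.snd_lt
  have key : (v.1 - w.1) * b - (w.2 - v.2) * c
      = α * (e.1 * b - e.2 * c) + β * (e'.1 * b - e'.2 * c) := by
    rw [h1, h2]; ring
  rcases le_or_gt 0 α with hα | hα <;> rcases le_or_gt β 0 with hβ | hβ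
  · nlinarith [mul_nonneg hα hr, mul_nonneg_of_nonpos_of_nonpos hβ hr']
  · exfalso
    nlinarith
  · exfalso
    nlinarith
  · exfalso
    -- The three cases contradict, in turn, the bound on `w.1`, the missing corner, and the bound on
    -- `w.2`.
    rcases lt_trichotomy β (-α) with hc | hc | hc
    · have : β * e'.1 ≤ (-α - 1) * e'.1 := mul_le_mul_of_nonneg_right (by omega) e1
      have : 0 ≤ (-α - 1) * (e.1 - e'.1) := mul_nonneg (by omega) (by omega)
      nlinarith
    · apply hw.not_corner
      subst hc
      have : 0 ≤ (-α - 1) * (e.1 - e'.1) := mul_nonneg (by omega) (by omega)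
      have : 0 ≤ (-α - 1) * (e'.2 - e.2) := mul_nonneg (by omega) (by omega)
      constructor <;> nlinarith
    · have : (-α + 1) * e'.2 ≤ β * e'.2 := mul_le_mul_of_nonneg_right (by omega) (by omega)
      have : 0 ≤ (-α) * (e'.2 - e.2) := mul_nonneg (by omega) (by omega)
      nlinarith

/-- Subtracting the next fan vector as often as possible moves a point from one cell to the
next. -/
theorem InCell.next {e e' w : ℤ × ℤ} {q : ℤ} (hpos : 0 < e'.1)
    (h1 : 0 ≤ (q • e' - e).1) (h3 : 0 ≤ e.2) (h4 : e.2 < e'.2) (hw : InCell e e' w) :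
    InCell e' (q • e' - e) (w.1 % e'.1, w.2 + w.1 / e'.1 * e'.2) := by
  obtain ⟨a1, a2, a3, a4, a5⟩ := hw
  simp only [Prod.fst_sub, Prod.smul_fst, smul_eq_mul] at h1
  have hdm := Int.emod_add_mul_ediv w.1 e'.1
  have hm0 := Int.emod_nonneg w.1 hpos.ne'
  have hm1 := Int.emod_lt_of_pos w.1 hpos
  have ht0 : 0 ≤ w.1 / e'.1 := Int.ediv_nonneg a1 hpos.le
  generalize w.1 / e'.1 = t at *
  generalize w.1 % e'.1 = x at *
  have htq : t ≤ q - 1 := by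
    by_contra hc
    nlinarith
  -- For `t = q - 1`, `w.1 ≥ (q - 1) * e'.1 ≥ e.1 - e'.1`, so the missing corner bounds `w.2`.
  have hlast : t = q - 1 → w.2 < e'.2 - e.2 := by
    intro ht
    by_contra hc
    refine a5 ⟨?_, by omega⟩
    subst ht
    nlinarith
  refine ⟨hm0, hm1, by nlinarith, ?_, ?_⟩
  · simp only [Prod.snd_sub, Prod.smul_snd, smul_eq_mul]
    rcases eq_or_lt_of_le htq with ht | ht
    · have := hlast ht
      subst ht
      nlinarith
    · have : t * e'.2 ≤ (q - 2) * e'.2 := mul_le_mul_of_nonneg_right (by omega) (by omega)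
      nlinarith
  · simp only [Prod.fst_sub, Prod.snd_sub, Prod.smul_fst, Prod.smul_snd, smul_eq_mul]
    rintro ⟨c1, c2⟩
    -- The new corner pulls back past `e.1` when `t = q - 1`, and to the old corner when `t = q -
    -- 2`; it is too high to be reached when `t ≤ q - 3`.
    rcases eq_or_lt_of_le htq with ht | ht
    · subst ht
      nlinarith
    · rcases eq_or_lt_of_le (show t ≤ q - 2 by omega) with ht' | ht'
      · subst ht'
        apply a5
        constructor <;> nlinarith
      · have : t * e'.2 ≤ (q - 3) * e'.2 := mul_le_mul_of_nonneg_right (by omega) (by omega)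
        nlinarith

/-! ### Greedy expansions. -/

/-- The greedy expansion of the first coordinate of `w` along the sequence `e`. -/
def greedy (e : ℕ → ℤ × ℤ) (w : ℤ × ℤ) : ℕ → ℤ × ℤ
  | 0 => w
  | k + 1 => ((greedy e w k).1 % (e (k + 1)).1,
      (greedy e w k).2 + (greedy e w k).1 / (e (k + 1)).1 * (e (k + 1)).2)

/-- The digits of the greedy expansion. -/
def greedyDigit (e : ℕ → ℤ × ℤ) (w : ℤ × ℤ) (k : ℕ) : ℤ :=
  (greedy e w (k - 1)).1 / (e k).1


theorem greedy_fst_eq (e : ℕ → ℤ × ℤ) (w : ℤ × ℤ) {k l : ℕ} (h : k ≤ l) :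
    (greedy e w k).1 = (greedy e w l).1
      + ∑ i ∈ Finset.Ioc k l, greedyDigit e w i * (e i).1 := by
  induction l, h using Nat.le_induction with
  | base => simp
  | succ l h ih =>
    rw [ih, Finset.sum_Ioc_succ_top h]
    have := Int.emod_add_mul_ediv (greedy e w l).1 (e (l + 1)).1
    simp only [greedy, greedyDigit, Nat.add_sub_cancel]
    linarith

theorem greedy_snd_eq (e : ℕ → ℤ × ℤ) (w : ℤ × ℤ) {k l : ℕ} (h : k ≤ l) :
    (greedy e w l).2 = (greedy e w k).2
      + ∑ i ∈ Finset.Ioc k l, greedyDigit e w i * (e i).2 := by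
  induction l, h using Nat.le_induction with
  | base => simp
  | succ l h ih =>
    rw [Finset.sum_Ioc_succ_top h, ← add_assoc, ← ih]
    simp only [greedy, greedyDigit, Nat.add_sub_cancel]

/-! ### The semigroup, its localizations and the group of the `x_j`. -/

namespace SimplicialData

theorem a_pos {n : ℕ} {H : Type*} (D : SimplicialData n H) (j : Fin n) : (0 : ℤ) < D.a j := by
  exact_mod_cast Nat.pos_of_ne_zero (D.a_ne_zero j)

variable {n : ℕ} {H : Type*} [AddCommGroup H] (D : SimplicialData n H)

/-- The group generated by the degrees of the `x_i`. -/
def xGroup : AddSubgroup ((Fin n → ℤ) × H) := AddSubgroup.closure (Set.range D.x)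

theorem mem_xGroup {v : (Fin n → ℤ) × H} :
    v ∈ D.xGroup ↔ ∃ k : Fin n → ℤ, v = ∑ j, k j • D.x j := by
  rw [xGroup, AddSubgroup.mem_closure_range_iff_of_fintype]

theorem mem_Ltilde {w : ℤ × ℤ} : w ∈ D.Ltilde ↔ w.1 • D.z - w.2 • D.y ∈ D.xGroup := Iff.rfl

theorem sum_x_mem_xGroup (k : Fin n → ℤ) : ∑ j, k j • D.x j ∈ D.xGroup :=
  D.mem_xGroup.2 ⟨k, rfl⟩

theorem sum_x_fst (k : Fin n → ℤ) (i : Fin n) : (∑ j, k j • D.x j).1 i = k i * D.a i := by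
  simp [x, Prod.fst_sum, Finset.sum_apply, Pi.single_apply]

theorem x_mem_S (j : Fin n) : D.x j ∈ D.S := AddSubmonoid.subset_closure (Or.inl ⟨j, rfl⟩)

theorem z_mem_S : D.z ∈ D.S := AddSubmonoid.subset_closure (Or.inr (Or.inl rfl))

theorem y_mem_S : D.y ∈ D.S := AddSubmonoid.subset_closure (Or.inr (Or.inr rfl))

theorem zsmul_mem_of_nonneg {G : Type*} [AddCommGroup G] (M : AddSubmonoid G) {g : G}
    (hg : g ∈ M) {k : ℤ} (hk : 0 ≤ k) : k • g ∈ M := by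
  lift k to ℕ using hk
  rw [natCast_zsmul]
  exact M.nsmul_mem hg k

theorem sum_x_mem_S {k : Fin n → ℤ} (hk : ∀ j, 0 ≤ k j) : ∑ j, k j • D.x j ∈ D.S :=
  D.S.sum_mem fun j _ => zsmul_mem_of_nonneg _ (D.x_mem_S j) (hk j)

/-- Only `x_j` contributes to the `j`-th coordinate, so the sign of that coordinate is the sign of
the coefficient of `x_j`. -/
theorem mem_S_of_mem_xGroup {v : (Fin n → ℤ) × H} (hv : v ∈ D.xGroup) (h0 : ∀ j, 0 ≤ v.1 j) :
    v ∈ D.S := by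
  obtain ⟨k, rfl⟩ := D.mem_xGroup.1 hv
  refine D.sum_x_mem_S fun j => ?_
  have := h0 j
  rw [D.sum_x_fst] at this
  exact nonneg_of_mul_nonneg_left this (D.a_pos j)

theorem exists_of_mem_S {u : (Fin n → ℤ) × H} (hu : u ∈ D.S) :
    ∃ (k : Fin n → ℤ) (s p : ℤ), (∀ j, 0 ≤ k j) ∧ 0 ≤ s ∧ 0 ≤ p ∧
      u = ∑ j, k j • D.x j + s • D.z + p • D.y := by
  induction hu using AddSubmonoid.closure_induction with
  | mem g hg =>
    rcases hg with ⟨j, rfl⟩ | rfl | rfl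
    · exact ⟨Pi.single j 1, 0, 0, fun i => by by_cases h : i = j <;> simp [h],
        le_rfl, le_rfl, by simp [Pi.single_apply, ite_smul]⟩
    · exact ⟨0, 1, 0, fun _ => le_rfl, by simp, le_rfl, by simp⟩
    · exact ⟨0, 0, 1, fun _ => le_rfl, le_rfl, by simp, by simp⟩
  | zero => exact ⟨0, 0, 0, fun _ => le_rfl, le_rfl, le_rfl, by simp⟩
  | add u v _ _ hu hv =>
    obtain ⟨k, s, p, hk, hs, hp, rfl⟩ := hu
    obtain ⟨k', s', p', hk', hs', hp', rfl⟩ := hv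
    refine ⟨k + k', s + s', p + p', fun j => add_nonneg (hk j) (hk' j), add_nonneg hs hs',
      add_nonneg hp hp', ?_⟩
    simp only [Pi.add_apply, add_smul, Finset.sum_add_distrib]
    abel

/-- A positive multiple of any element of `ℤⁿ ⊕ H` lies in the group of the `x_i`. -/
theorem exists_zsmul_mem_xGroup [Finite H] :
    ∃ K : ℤ, 1 ≤ K ∧ ∀ g : (Fin n → ℤ) × H, K • g ∈ D.xGroup := by
  have hcard : 0 < Nat.card H := Nat.card_pos
  have hprod : 0 < ∏ j, D.a j := Finset.prod_pos fun j _ => Nat.pos_of_ne_zero (D.a_ne_zero j)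
  refine ⟨((Nat.card H * ∏ j, D.a j : ℕ) : ℤ), by exact_mod_cast Nat.mul_pos hcard hprod,
    fun g => ?_⟩
  have hH : ∀ h : H, (Nat.card H : ℤ) • h = 0 := fun h => by
    rw [natCast_zsmul, card_nsmul_eq_zero']
  choose d hd using fun j => Finset.dvd_prod_of_mem D.a (Finset.mem_univ j)
  rw [mem_xGroup]
  -- The product of the `a j` makes the coordinates divisible; the factor `Nat.card H` kills both
  -- `H`-components.
  refine ⟨fun j => (Nat.card H : ℤ) * (d j * g.1 j), ?_⟩
  refine Prod.ext (funext fun i => ?_) ?_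
  · rw [sum_x_fst]
    simp only [Prod.smul_fst, Pi.smul_apply, smul_eq_mul]
    rw [hd i]
    push_cast
    ring
  · simp only [Prod.smul_snd, Prod.snd_sum, mul_smul, hH, Finset.sum_const_zero, Nat.cast_mul]

theorem exists_of_mem_localization [Finite H] {g : (Fin n → ℤ) × H} {i : Fin n}
    (hg : g ∈ D.localization i) :
    ∃ v : ℤ × ℤ, 0 ≤ v.1 ∧ 0 ≤ v.2 ∧ g - (v.1 • D.z + v.2 • D.y) ∈ D.xGroup ∧
      v.1 * D.b i + v.2 * D.c i ≤ g.1 i := by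
  obtain ⟨u, hu, v, hv, hvi, rfl⟩ := hg
  obtain ⟨K, hK, hKmem⟩ := D.exists_zsmul_mem_xGroup
  obtain ⟨k, s, p, hk, hs, hp, rfl⟩ := D.exists_of_mem_S hu
  obtain ⟨k', s', p', hk', hs', hp', rfl⟩ := D.exists_of_mem_S hv
  have ha := D.a_pos i
  have hb : (0 : ℤ) ≤ D.b i := by positivity
  have hc : (0 : ℤ) ≤ D.c i := by positivity
  simp only [Prod.fst_add, Pi.add_apply, D.sum_x_fst, Prod.smul_fst, Pi.smul_apply, smul_eq_mul,
    z, y] at hvi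
  have h1 := mul_nonneg (hk' i) ha.le
  have h2 := mul_nonneg hs' hb
  have h3 := mul_nonneg hp' hc
  have h2' : s' * D.b i = 0 := by linarith
  have h3' : p' * D.c i = 0 := by linarith
  have h4 := mul_nonneg (hk i) ha.le
  -- Adding `K` times the `z`, `y` part of the denominator makes the exponents nonnegative without
  -- leaving the coset. It costs nothing in coordinate `i`, where that part vanishes.
  refine ⟨(s + (K - 1) * s', p + (K - 1) * p'), add_nonneg hs (mul_nonneg (by omega) hs'),
    add_nonneg hp (mul_nonneg (by omega) hp'), ?_, ?_⟩
  · have h := D.xGroup.sub_mem (D.xGroup.sub_mem (D.sum_x_mem_xGroup k) (D.sum_x_mem_xGroup k'))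
      (hKmem (s' • D.z + p' • D.y))
    convert h using 1
    module
  · simp only [Prod.fst_sub, Prod.fst_add, Pi.sub_apply, Pi.add_apply, D.sum_x_fst, Prod.smul_fst,
      Pi.smul_apply, smul_eq_mul, z, y]
    nlinarith

/-! ### The fan of `Ltilde` and representatives in its cells. -/

theorem isFanBasis_zero [Finite H] : IsFanBasis D.Ltilde (D.epsAux 0) (D.epsAux 1) := by
  obtain ⟨K, hK, hKmem⟩ := D.exists_zsmul_mem_xGroup
  obtain ⟨K, rfl⟩ := Int.eq_ofNat_of_zero_le (by omega : 0 ≤ K)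
  have hs : {s : ℕ | 0 < s ∧ ((s : ℤ), (0 : ℤ)) ∈ D.Ltilde}.Nonempty :=
    ⟨K, by omega, by simpa [mem_Ltilde] using hKmem D.z⟩
  have hp : {p : ℕ | 0 < p ∧ ∃ s : ℤ, (s, (p : ℤ)) ∈ D.Ltilde}.Nonempty :=
    ⟨K, by omega, 0, by simpa [mem_Ltilde] using hKmem D.y⟩
  obtain ⟨hs0, hsmem⟩ : 0 < D.sInit ∧ ((D.sInit : ℤ), (0 : ℤ)) ∈ D.Ltilde := Nat.sInf_mem hs
  obtain ⟨hp0, s, hpmem⟩ : 0 < D.pZero ∧ ∃ s : ℤ, (s, (D.pZero : ℤ)) ∈ D.Ltilde :=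
    Nat.sInf_mem hp
  have hs0' : (0 : ℤ) < D.sInit := by exact_mod_cast hs0
  have hp0' : (0 : ℤ) < D.pZero := by exact_mod_cast hp0
  have hred : ∀ s p : ℤ, (s, p) ∈ D.Ltilde → (s % D.sInit, p) ∈ D.Ltilde := fun s p h => by
    have h' := D.Ltilde.sub_mem h (D.Ltilde.zsmul_mem hsmem (s / D.sInit))
    convert h' using 1
    have := Int.emod_add_mul_ediv s D.sInit
    ext
    · simp; linarith
    · simp
  have hz : {s : ℕ | ((s : ℤ), (D.pZero : ℤ)) ∈ D.Ltilde}.Nonempty := by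
    obtain ⟨k, hk⟩ := Int.eq_ofNat_of_zero_le (Int.emod_nonneg s hs0'.ne')
    exact ⟨k, by simpa [← hk] using hred _ _ hpmem⟩
  have hzmem : ((D.sZero : ℤ), (D.pZero : ℤ)) ∈ D.Ltilde := Nat.sInf_mem hz
  have hlt : D.sZero < D.sInit := by
    by_contra! hc
    have hmem : D.sZero - D.sInit ∈ {s : ℕ | ((s : ℤ), (D.pZero : ℤ)) ∈ D.Ltilde} := by
      have := D.Ltilde.sub_mem hzmem hsmem
      simpa [Nat.cast_sub hc] using this
    have := Nat.sInf_le hmem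
    change D.sZero ≤ _ at this
    omega
  refine ⟨hsmem, hzmem, by simp [epsAux], by simpa [epsAux] using hlt, by simp [epsAux],
    by simpa [epsAux] using hp0, ?_⟩
  rintro ⟨s, p⟩ hw
  have hp1 := Int.emod_nonneg p hp0'.ne'
  have hp2 := Int.emod_lt_of_pos p hp0'
  have hp3 := Int.emod_add_mul_ediv p D.pZero
  have hsub := D.Ltilde.sub_mem hw (D.Ltilde.zsmul_mem hzmem (p / D.pZero))
  have hp4 : p % D.pZero = 0 := by
    by_contra hne
    obtain ⟨k, hk⟩ := Int.eq_ofNat_of_zero_le hp1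
    have hmem : k ∈ {p : ℕ | 0 < p ∧ ∃ s : ℤ, (s, (p : ℤ)) ∈ D.Ltilde} := by
      refine ⟨by omega, s - p / D.pZero * D.sZero, ?_⟩
      convert hsub using 1
      ext
      · simp
      · simp; linarith
    have := Nat.sInf_le hmem
    change D.pZero ≤ _ at this
    omega
  obtain ⟨s', hs'⟩ : ∃ s', s' = s - p / D.pZero * D.sZero := ⟨_, rfl⟩
  have hs'mem : (s', (0 : ℤ)) ∈ D.Ltilde := by
    convert hsub using 1
    ext
    · simp [hs']
    · simp; linarith
  have hs1 := Int.emod_nonneg s' hs0'.ne'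
  have hs2 := Int.emod_lt_of_pos s' hs0'
  have hs3 := Int.emod_add_mul_ediv s' D.sInit
  have hs4 : s' % D.sInit = 0 := by
    by_contra hne
    obtain ⟨k, hk⟩ := Int.eq_ofNat_of_zero_le hs1
    have hmem : k ∈ {s : ℕ | 0 < s ∧ ((s : ℤ), (0 : ℤ)) ∈ D.Ltilde} :=
      ⟨by omega, by simpa [← hk] using hred _ _ hs'mem⟩
    have := Nat.sInf_le hmem
    change D.sInit ≤ _ at this
    omega
  refine ⟨s' / D.sInit, p / D.pZero, ?_⟩
  ext
  · simp [epsAux]; linarith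
  · simp [epsAux]; linarith

/-- The first index at which the first coordinate of the fan vectors vanishes exists. -/
theorem exists_epsAux_fst_eq_zero [Finite H] : ∃ k, (D.epsAux k).1 = 0 := by
  by_contra! hne
  have key : ∀ k, IsFanBasis D.Ltilde (D.epsAux k) (D.epsAux (k + 1)) := fun k => by
    induction k with
    | zero => exact D.isFanBasis_zero
    | succ k ih => exact (ih.next (lt_of_le_of_ne ih.fst_nonneg (hne _).symm)).2
  have hle : ∀ k : ℕ, (D.epsAux k).1 + k ≤ (D.epsAux 0).1 := fun k => by
    induction k with
    | zero => simp
    | succ k ih =>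
      have := (key k).fst_lt
      push_cast
      omega
  have h1 := hle ((D.epsAux 0).1.toNat + 1)
  have h2 := (key ((D.epsAux 0).1.toNat)).fst_nonneg
  push_cast at h1
  omega

/-- The number of fan vectors with positive first coordinate. -/
noncomputable def fanLength : ℕ := sInf {k | (D.epsAux k).1 = 0}

section Fan

variable [Finite H]

theorem epsAux_fanLength : (D.epsAux D.fanLength).1 = 0 :=
  Nat.sInf_mem (s := {k | (D.epsAux k).1 = 0}) D.exists_epsAux_fst_eq_zero

theorem epsAux_ne_zero {n : ℕ} {H : Type*} [AddCommGroup H] (D : SimplicialData n H) {k : ℕ}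
    (hk : k < D.fanLength) : (D.epsAux k).1 ≠ 0 :=
  Nat.notMem_of_lt_sInf hk

theorem isFanBasis {k : ℕ} (hk : k < D.fanLength) :
    IsFanBasis D.Ltilde (D.epsAux k) (D.epsAux (k + 1)) := by
  induction k with
  | zero => exact D.isFanBasis_zero
  | succ k ih =>
    have h := ih (by omega)
    exact (h.next (lt_of_le_of_ne h.fst_nonneg (D.epsAux_ne_zero hk).symm)).2

theorem fanLength_pos : 0 < D.fanLength := by
  by_contra! h
  have h0 := D.epsAux_fanLength
  rw [Nat.le_zero.1 h] at h0
  have := D.isFanBasis_zero.fst_lt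
  have := D.isFanBasis_zero.fst_nonneg
  omega

theorem epsAux_mem {k : ℕ} (hk : k ≤ D.fanLength) : D.epsAux k ∈ D.Ltilde := by
  rcases hk.lt_or_eq with h | h
  · exact (D.isFanBasis h).left_mem
  · obtain ⟨l, hl⟩ := Nat.exists_eq_succ_of_ne_zero D.fanLength_pos.ne'
    rw [h, hl]
    exact (D.isFanBasis (by omega : l < D.fanLength)).right_mem

theorem epsAux_fst_nonneg {k : ℕ} (hk : k ≤ D.fanLength) : 0 ≤ (D.epsAux k).1 := by
  rcases hk.lt_or_eq with h | h
  · have h := D.isFanBasis h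
    exact h.fst_nonneg.trans h.fst_lt.le
  · rw [h, D.epsAux_fanLength]

theorem epsAux_snd_nonneg {k : ℕ} (hk : k ≤ D.fanLength) : 0 ≤ (D.epsAux k).2 := by
  cases k with
  | zero => simp [epsAux]
  | succ k =>
    have h := D.isFanBasis (by omega : k < D.fanLength)
    exact h.snd_nonneg.trans h.snd_lt.le

/-- The greedy expansion of a point of the first cell stays in the cells. -/
theorem inCell_greedy {w : ℤ × ℤ} (hw : InCell (D.epsAux 0) (D.epsAux 1) w) {k : ℕ}
    (hk : k < D.fanLength) :
    InCell (D.epsAux k) (D.epsAux (k + 1)) (greedy D.epsAux w k) := by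
  induction k with
  | zero => exact hw
  | succ k ih =>
    have h := D.isFanBasis (by omega : k < D.fanLength)
    have hpos := lt_of_le_of_ne h.fst_nonneg (D.epsAux_ne_zero hk).symm
    exact (ih (by omega)).next hpos (h.next hpos).2.fst_nonneg h.snd_nonneg h.snd_lt

theorem greedyDigit_nonneg {w : ℤ × ℤ} (hw : InCell (D.epsAux 0) (D.epsAux 1) w) {k : ℕ}
    (hk0 : 1 ≤ k) (hk : k ≤ D.fanLength) : 0 ≤ greedyDigit D.epsAux w k :=
  Int.ediv_nonneg (D.inCell_greedy hw (by omega)).fst_nonneg (D.epsAux_fst_nonneg hk)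

theorem greedy_sub_mem_xGroup {g : (Fin n → ℤ) × H} {w : ℤ × ℤ}
    (hg : g - (w.1 • D.z + w.2 • D.y) ∈ D.xGroup) {k : ℕ} (hk : k ≤ D.fanLength) :
    g - ((greedy D.epsAux w k).1 • D.z + (greedy D.epsAux w k).2 • D.y) ∈ D.xGroup := by
  induction k with
  | zero => exact hg
  | succ k ih =>
    have h := D.xGroup.add_mem (ih (by omega)) (D.xGroup.zsmul_mem (D.epsAux_mem hk)
      ((greedy D.epsAux w k).1 / (D.epsAux (k + 1)).1))
    convert h using 1
    have := Int.emod_def (greedy D.epsAux w k).1 (D.epsAux (k + 1)).1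
    simp only [greedy, this]
    module

/-- Because `ε_{-1}` has second coordinate `0`, the first cell is a full rectangle: reduce `p`
modulo `p_0` using `ε_0`, then `s` modulo `s_{-1}`. -/
theorem exists_inCell {g : (Fin n → ℤ) × H} {v : ℤ × ℤ}
    (hg : g - (v.1 • D.z + v.2 • D.y) ∈ D.xGroup) :
    ∃ w, InCell (D.epsAux 0) (D.epsAux 1) w ∧ g - (w.1 • D.z + w.2 • D.y) ∈ D.xGroup := by
  have h := D.isFanBasis_zero
  have hs : 0 < (D.epsAux 0).1 := h.fst_nonneg.trans_lt h.fst_lt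
  have hp : 0 < (D.epsAux 1).2 := h.snd_nonneg.trans_lt h.snd_lt
  obtain ⟨s', hs'⟩ : ∃ s', s' = v.1 + v.2 / (D.epsAux 1).2 * (D.epsAux 1).1 := ⟨_, rfl⟩
  have h0 : (D.epsAux 0).2 = 0 := rfl
  refine ⟨(s' % (D.epsAux 0).1, v.2 % (D.epsAux 1).2), ⟨Int.emod_nonneg _ hs.ne',
    Int.emod_lt_of_pos _ hs, Int.emod_nonneg _ hp.ne', Int.emod_lt_of_pos _ hp, ?_⟩, ?_⟩
  · have := Int.emod_lt_of_pos v.2 hp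
    rintro ⟨-, h2⟩
    simp only [h0] at h2
    omega
  · have h1 := D.xGroup.zsmul_mem h.left_mem (s' / (D.epsAux 0).1)
    have h2 := D.xGroup.zsmul_mem h.right_mem (v.2 / (D.epsAux 1).2)
    have h3 := D.xGroup.add_mem (D.xGroup.sub_mem hg h2) h1
    convert h3 using 1
    simp only [Int.emod_def, h0, hs']
    module

end Fan

/-! ### The vectors `r_i`, the indices `ν` and `μ`, and the elements `E_i`. -/

theorem s_natCast_sub_one (k : ℕ) : D.s ((k : ℤ) - 1) = (D.epsAux k).1 := by simp [s]

theorem p_natCast_sub_one (k : ℕ) : D.p ((k : ℤ) - 1) = (D.epsAux k).2 := by simp [p]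

/-- The numerator of the coordinate `r_{j,k-1}`. -/
noncomputable def rNum (k : ℕ) (j : Fin n) : ℤ := (D.epsAux k).1 * D.b j - (D.epsAux k).2 * D.c j

theorem sub_mem_localization {i : Fin n} {u v : (Fin n → ℤ) × H} (hu : u ∈ D.S) (hv : v ∈ D.S)
    (h : v.1 i = 0) : u - v ∈ D.localization i :=
  ⟨u, hu, v, hv, h, rfl⟩

theorem S_le_S' : D.S ≤ D.S' := by
  refine le_iInf fun i u hu => ?_
  simpa using D.sub_mem_localization hu D.S.zero_mem (i := i) rfl

variable [Finite H]

/-- The coefficients of an element of the `x`-group are read off from its coordinates, so the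
division defining `r` is exact on the fan. -/
theorem sub_eq_sum_r {k : ℕ} (hk : k ≤ D.fanLength) :
    (D.epsAux k).1 • D.z - (D.epsAux k).2 • D.y = ∑ j, D.r ((k : ℤ) - 1) j • D.x j ∧
      ∀ j, D.r ((k : ℤ) - 1) j * D.a j = D.rNum k j := by
  obtain ⟨d, hd⟩ := D.mem_xGroup.1 (D.epsAux_mem hk)
  have hcoord : ∀ j, d j * D.a j = D.rNum k j := fun j => by
    have := congrArg (fun g => g.1 j) hd
    simp only [D.sum_x_fst] at this
    rw [← this]
    simp [rNum, z, y]
  have hr : ∀ j, D.r ((k : ℤ) - 1) j = d j := fun j => by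
    rw [r, s_natCast_sub_one, p_natCast_sub_one]
    exact Int.ediv_eq_of_eq_mul_left (D.a_pos j).ne' (hcoord j).symm
  simp only [hr]
  exact ⟨hd, hcoord⟩

theorem r_nonneg_iff {k : ℕ} (hk : k ≤ D.fanLength) (j : Fin n) :
    0 ≤ D.r ((k : ℤ) - 1) j ↔ 0 ≤ D.rNum k j := by
  rw [← (D.sub_eq_sum_r hk).2 j, mul_nonneg_iff_of_pos_right (D.a_pos j)]

theorem r_nonpos_iff {k : ℕ} (hk : k ≤ D.fanLength) (j : Fin n) :
    D.r ((k : ℤ) - 1) j ≤ 0 ↔ D.rNum k j ≤ 0 := by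
  rw [← (D.sub_eq_sum_r hk).2 j]
  exact ⟨fun h => mul_nonpos_of_nonpos_of_nonneg h (D.a_pos j).le,
    fun h => nonpos_of_mul_nonpos_left h (D.a_pos j)⟩

/-- Along the fan `s_i` decreases and `p_i` increases, while `b` and `c` are nonnegative. Hence each
coordinate of `r_i` passes from nonnegative to nonpositive at most once. -/
theorem rNum_succ_le {k : ℕ} (hk : k < D.fanLength) (j : Fin n) :
    D.rNum (k + 1) j ≤ D.rNum k j := by
  have h := D.isFanBasis hk
  exact sub_le_sub (mul_le_mul_of_nonneg_right h.fst_lt.le (by positivity))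
    (mul_le_mul_of_nonneg_right h.snd_lt.le (by positivity))

theorem rNum_anti {k l : ℕ} (hkl : k ≤ l) (hl : l ≤ D.fanLength) (j : Fin n) :
    D.rNum l j ≤ D.rNum k j := by
  induction l, hkl using Nat.le_induction with
  | base => exact le_rfl
  | succ l h ih => exact (D.rNum_succ_le hl j).trans (ih (by omega))

/-- The shift `epsAux k = ε_{k-1}` puts the first zero of `s` at the index `fanLength - 1 = m + 1`.
-/
theorem m_eq : D.m = (D.fanLength : ℤ) - 2 := by
  have hpos := D.fanLength_pos
  refine IsLeast.csInf_eq ⟨⟨by omega, ?_⟩, ?_⟩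
  · rw [show (D.fanLength : ℤ) - 2 + 1 = D.fanLength - 1 by ring, s_natCast_sub_one,
      epsAux_fanLength]
  · rintro i ⟨hi, h0⟩
    obtain ⟨k, hk⟩ := Int.eq_ofNat_of_zero_le (by omega : 0 ≤ i + 2)
    rw [show i + 1 = (k : ℤ) - 1 by omega, s_natCast_sub_one] at h0
    have : D.fanLength ≤ k := Nat.sInf_le h0
    omega

/-- The index `ν + 1`, as a natural number. -/
theorem exists_nu : ∃ k : ℕ, D.nu = (k : ℤ) - 1 ∧ k < D.fanLength ∧ ∀ j, 0 ≤ D.rNum k j := by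
  have hpos := D.fanLength_pos
  have hm := D.m_eq
  have hne : {i : ℤ | -1 ≤ i ∧ i ≤ D.m + 1 ∧ ∀ j, 0 ≤ D.r i j}.Nonempty := by
    refine ⟨((0 : ℕ) : ℤ) - 1, by simp, by simp; omega, fun j => ?_⟩
    rw [D.r_nonneg_iff hpos.le]
    simp only [rNum, epsAux, zero_mul, sub_zero]
    positivity
  obtain ⟨h1, h2, h3⟩ := Int.csSup_mem hne ⟨D.m + 1, fun i hi => hi.2.1⟩
  change -1 ≤ D.nu at h1
  change D.nu ≤ _ at h2
  change ∀ j, 0 ≤ D.r D.nu j at h3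
  obtain ⟨k, hk⟩ := Int.eq_ofNat_of_zero_le (by omega : 0 ≤ D.nu + 1)
  have hk' : D.nu = (k : ℤ) - 1 := by omega
  rw [hk'] at h3
  have hkN : k ≤ D.fanLength := by omega
  have h4 : ∀ j, 0 ≤ D.rNum k j := fun j => (D.r_nonneg_iff hkN j).1 (h3 j)
  refine ⟨k, hk', lt_of_le_of_ne hkN ?_, h4⟩
  -- At the last fan vector `s = 0` and `p > 0`, so nonnegativity would force `c = 0`.
  rintro rfl
  apply D.c_ne_zero
  funext j
  obtain ⟨l, hl⟩ := Nat.exists_eq_succ_of_ne_zero hpos.ne'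
  have hf := D.isFanBasis (by omega : l < D.fanLength)
  have hp : 0 < (D.epsAux D.fanLength).2 := by
    rw [hl]
    exact hf.snd_nonneg.trans_lt hf.snd_lt
  have h5 := h4 j
  rw [rNum, D.epsAux_fanLength] at h5
  have : (D.c j : ℤ) ≤ 0 := by nlinarith
  simpa using this

/-- The index `μ + 1`, as a natural number. -/
theorem exists_mu {k : ℕ} (hk : D.nu = (k : ℤ) - 1) (hkN : k < D.fanLength) :
    ∃ l : ℕ, D.mu = (l : ℤ) - 1 ∧ k ≤ l ∧ l < D.fanLength ∧ ∀ j, D.rNum (l + 1) j ≤ 0 := by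
  have hm := D.m_eq
  have hne : {i : ℤ | D.nu ≤ i ∧ i ≤ D.m ∧ ∀ j, D.r (i + 1) j ≤ 0}.Nonempty := by
    refine ⟨D.m, by omega, le_rfl, fun j => ?_⟩
    rw [show D.m + 1 = (D.fanLength : ℤ) - 1 by omega, D.r_nonpos_iff le_rfl, rNum,
      epsAux_fanLength]
    have := D.epsAux_snd_nonneg le_rfl
    have : 0 ≤ (D.epsAux D.fanLength).2 * D.c j := by positivity
    omega
  obtain ⟨h1, h2, h3⟩ := Int.csInf_mem hne ⟨D.nu, fun i hi => hi.1⟩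
  change D.nu ≤ D.mu at h1
  change D.mu ≤ _ at h2
  change ∀ j, D.r (D.mu + 1) j ≤ 0 at h3
  obtain ⟨l, hl⟩ := Int.eq_ofNat_of_zero_le (by omega : 0 ≤ D.mu + 1)
  refine ⟨l, by omega, by omega, by omega, fun j => ?_⟩
  have h4 := h3 j
  rwa [show D.mu + 1 = ((l + 1 : ℕ) : ℤ) - 1 by push_cast; omega, D.r_nonpos_iff (by omega)] at h4

theorem yForm_eq_zForm {k : ℕ} (hk : k ≤ D.fanLength) :
    D.yForm ((k : ℤ) - 1) = D.zForm ((k : ℤ) - 1) := by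
  have h := (D.sub_eq_sum_r hk).1
  have hsum : ∑ j, D.r ((k : ℤ) - 1) j • D.x j
      = ∑ j, (D.r ((k : ℤ) - 1) j)⁺ • D.x j - ∑ j, (D.r ((k : ℤ) - 1) j)⁻ • D.x j := by
    rw [← Finset.sum_sub_distrib]
    exact Finset.sum_congr rfl fun j _ => by rw [← sub_smul, posPart_sub_negPart]
  rw [hsum, sub_eq_sub_iff_add_eq_add] at h
  rw [yForm, zForm, s_natCast_sub_one, p_natCast_sub_one, sub_eq_sub_iff_add_eq_add, h]
  abel

theorem yForm_fst_of_nonneg {k : ℕ} (hk : k ≤ D.fanLength) {j : Fin n} (h : 0 ≤ D.rNum k j) :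
    (D.yForm ((k : ℤ) - 1)).1 j = (D.epsAux k).2 * D.c j := by
  rw [← D.r_nonneg_iff hk] at h
  rw [yForm, Prod.fst_sub, Pi.sub_apply, sum_x_fst, negPart_eq_zero.2 h, p_natCast_sub_one]
  simp [y]

theorem yForm_fst_of_nonpos {k : ℕ} (hk : k ≤ D.fanLength) {j : Fin n} (h : D.rNum k j ≤ 0) :
    (D.yForm ((k : ℤ) - 1)).1 j = (D.epsAux k).1 * D.b j := by
  rw [← D.r_nonpos_iff hk] at h
  rw [yForm_eq_zForm D hk, zForm, Prod.fst_sub, Pi.sub_apply, sum_x_fst, posPart_eq_zero.2 h,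
    s_natCast_sub_one]
  simp [z]

theorem yForm_sub_mem_xGroup {k : ℕ} (hk : k ≤ D.fanLength) :
    D.yForm ((k : ℤ) - 1) - (D.epsAux k).1 • D.z ∈ D.xGroup := by
  rw [yForm_eq_zForm D hk, zForm, s_natCast_sub_one, sub_sub_cancel_left]
  exact D.xGroup.neg_mem (D.sum_x_mem_xGroup _)

theorem yForm_mem_S' {k : ℕ} (hk : k ≤ D.fanLength) : D.yForm ((k : ℤ) - 1) ∈ D.S' := by
  refine AddSubmonoid.mem_iInf.2 fun i => ?_
  rcases le_total 0 (D.rNum k i) with h | h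
  · rw [← D.r_nonneg_iff hk] at h
    refine D.sub_mem_localization (zsmul_mem_of_nonneg _ D.y_mem_S ?_)
      (D.sum_x_mem_S fun j => negPart_nonneg _) ?_
    · rw [p_natCast_sub_one]
      exact D.epsAux_snd_nonneg hk
    · rw [sum_x_fst, negPart_eq_zero.2 h, zero_mul]
  · rw [← D.r_nonpos_iff hk] at h
    rw [yForm_eq_zForm D hk]
    refine D.sub_mem_localization (zsmul_mem_of_nonneg _ D.z_mem_S ?_)
      (D.sum_x_mem_S fun j => posPart_nonneg _) ?_
    · rw [s_natCast_sub_one]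
      exact D.epsAux_fst_nonneg hk
    · rw [sum_x_fst, posPart_eq_zero.2 h, zero_mul]

/-! ### Decomposition of the elements of `S'`. -/

/-- The first coordinates of an element of the localization dominate the value of the `i`-th linear
form at the representative of its coset in any cell whose two fan vectors have `i`-th coordinates
of opposite signs. -/
theorem greedy_le_of_mem_localization {g : (Fin n → ℤ) × H} {i : Fin n}
    (hg : g ∈ D.localization i) {w : ℤ × ℤ} (hw : InCell (D.epsAux 0) (D.epsAux 1) w)
    (hgw : g - (w.1 • D.z + w.2 • D.y) ∈ D.xGroup) {k : ℕ} (hk : k < D.fanLength)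
    (h : 0 ≤ D.rNum k i) (h' : D.rNum (k + 1) i ≤ 0) :
    (greedy D.epsAux w k).1 * D.b i + (greedy D.epsAux w k).2 * D.c i ≤ g.1 i := by
  obtain ⟨v, hv1, hv2, hgv, hv⟩ := D.exists_of_mem_localization hg
  refine le_trans ?_ hv
  refine (D.inCell_greedy hw hk).le_of_sub_mem (D.isFanBasis hk) hv1 hv2 ?_ h h'
  rw [mem_Ltilde]
  convert D.xGroup.sub_mem (D.greedy_sub_mem_xGroup hgw hk.le) hgv using 1
  module

/-- Along the interval `(k, l]` of indices, the sign of `r_i` changes at most once. -/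
theorem exists_sign_change {n : ℕ} {H : Type*} [AddCommGroup H] (D : SimplicialData n H) {k l : ℕ}
    (hkl : k ≤ l) {i : Fin n} (hk0 : 0 ≤ D.rNum k i) (hl0 : D.rNum (l + 1) i ≤ 0) :
    ∃ t, k ≤ t ∧ t ≤ l ∧ 0 ≤ D.rNum t i ∧ D.rNum (t + 1) i ≤ 0 := by
  induction l, hkl using Nat.le_induction with
  | base => exact ⟨k, le_rfl, le_rfl, hk0, hl0⟩
  | succ l h ih =>
    rcases le_total 0 (D.rNum (l + 1) i) with h0 | h0
    · exact ⟨l + 1, by omega, le_rfl, h0, hl0⟩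
    · obtain ⟨t, h1, h2, h3⟩ := ih h0
      exact ⟨t, h1, by omega, h3⟩

/-- Every element of `S'` is, up to an element of `S`, a sum of elements `y^{p_i} / x^{r_{i,-}}`. -/
theorem exists_sub_sum_mem_S {g : (Fin n → ℤ) × H} (hg : g ∈ D.S') {k l : ℕ} (hkl : k ≤ l)
    (hl : l < D.fanLength) (hk0 : ∀ j, 0 ≤ D.rNum k j) (hl0 : ∀ j, D.rNum (l + 1) j ≤ 0) :
    ∃ t : ℕ → ℤ, (∀ i ∈ Finset.Ioc k l, 0 ≤ t i) ∧
      g - ∑ i ∈ Finset.Ioc k l, t i • D.yForm ((i : ℤ) - 1) ∈ D.S := by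
  have hloc : ∀ i, g ∈ D.localization i := AddSubmonoid.mem_iInf.1 hg
  -- Only the existence of an index is needed, to obtain some representative of the coset of `g`.
  obtain ⟨j0, -⟩ := Function.ne_iff.1 D.b_ne_zero
  obtain ⟨v, -, -, hgv, -⟩ := D.exists_of_mem_localization (hloc j0)
  obtain ⟨w, hw, hgw⟩ := D.exists_inCell hgv
  have hcell : ∀ i, i < D.fanLength → _ := fun i hi => D.inCell_greedy hw hi
  refine ⟨greedyDigit D.epsAux w, fun i hi => ?_, ?_⟩
  · rw [Finset.mem_Ioc] at hi
    exact D.greedyDigit_nonneg hw (by omega) (by omega)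
  obtain ⟨E, hE⟩ : ∃ E, E = ∑ i ∈ Finset.Ioc k l,
      greedyDigit D.epsAux w i • D.yForm ((i : ℤ) - 1) := ⟨_, rfl⟩
  have hA := (hcell l hl).fst_nonneg
  have hB := (hcell k (by omega)).snd_nonneg
  have hs := fun i (hi : i ≤ l) => greedy_fst_eq D.epsAux w hi
  have hp := fun i (hi : k ≤ i) => greedy_snd_eq D.epsAux w hi
  rw [← hE]
  -- The leftover `z`-exponent comes from the last cell `l`, the leftover `y`-exponent from the
  -- first cell `k`.
  have hmain : g - E - ((greedy D.epsAux w l).1 • D.z + (greedy D.epsAux w k).2 • D.y) ∈ D.S := by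
    apply mem_S_of_mem_xGroup
    · have h1 : ∑ i ∈ Finset.Ioc k l, greedyDigit D.epsAux w i •
          (D.yForm ((i : ℤ) - 1) - (D.epsAux i).1 • D.z) ∈ D.xGroup :=
        D.xGroup.sum_mem fun i hi => D.xGroup.zsmul_mem
          (D.yForm_sub_mem_xGroup (by rw [Finset.mem_Ioc] at hi; omega)) _
      have h2 := D.xGroup.sub_mem (D.greedy_sub_mem_xGroup hgw (by omega : k ≤ D.fanLength)) h1
      convert h2 using 1
      simp only [smul_sub, Finset.sum_sub_distrib, ← hE, smul_smul, ← Finset.sum_smul]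
      rw [hs k hkl]
      module
    · intro j
      obtain ⟨t, ht1, ht2, ht3, ht4⟩ := D.exists_sign_change hkl (hk0 j) (hl0 j)
      have h1 := D.greedy_le_of_mem_localization (hloc j) hw hgw (by omega) ht3 ht4
      -- Up to the sign change `t` of the `j`-th coordinate the `y`-fractions count, after it the
      -- `z`-fractions. With the leftovers the total is the `j`-th form at the representative in
      -- cell `t`.
      have hE1 : E.1 j = (∑ i ∈ Finset.Ioc k t, greedyDigit D.epsAux w i * (D.epsAux i).2) * D.c j
          + (∑ i ∈ Finset.Ioc t l, greedyDigit D.epsAux w i * (D.epsAux i).1) * D.b j := by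
        rw [hE, Prod.fst_sum, Finset.sum_apply, ← Finset.sum_Ioc_consecutive _ ht1 ht2,
          Finset.sum_mul, Finset.sum_mul]
        congr 1 <;> refine Finset.sum_congr rfl fun i hi => ?_ <;> rw [Finset.mem_Ioc] at hi
        · rw [Prod.smul_fst, Pi.smul_apply, smul_eq_mul, mul_assoc,
            D.yForm_fst_of_nonneg (by omega) (ht3.trans (D.rNum_anti hi.2 (by omega) j))]
        · rw [Prod.smul_fst, Pi.smul_apply, smul_eq_mul, mul_assoc,
            D.yForm_fst_of_nonpos (by omega) ((D.rNum_anti hi.1 (by omega) j).trans ht4)]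
      rw [hs t ht2, hp t ht1] at h1
      simp only [Prod.fst_sub, Prod.fst_add, Pi.sub_apply, Pi.add_apply, Prod.smul_fst,
        Pi.smul_apply, smul_eq_mul, z, y, hE1]
      linarith
  have := D.S.add_mem hmain (D.S.add_mem (zsmul_mem_of_nonneg _ D.z_mem_S hA)
    (zsmul_mem_of_nonneg _ D.y_mem_S hB))
  rwa [sub_add_cancel] at this

end SimplicialData

theorem theorem9 {n : ℕ} {H : Type*} [AddCommGroup H] [Finite H] (D : SimplicialData n H) :
    (∀ l : ℤ, 1 ≤ l → l ≤ D.mu - D.nu → D.yForm (D.nu + l) = D.zForm (D.nu + l)) ∧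
    D.S' = AddSubmonoid.closure
      ((D.S : Set ((Fin n → ℤ) × H)) ∪
        {E | ∃ l : ℤ, 1 ≤ l ∧ l ≤ D.mu - D.nu ∧ E = D.yForm (D.nu + l)}) := by
  obtain ⟨k, hk, hkN, hk0⟩ := D.exists_nu
  obtain ⟨l, hl, hkl, hlN, hl0⟩ := D.exists_mu hk hkN
  have hidx : ∀ i : ℤ, 1 ≤ i → i ≤ D.mu - D.nu →
      ∃ d : ℕ, d ≤ D.fanLength ∧ D.nu + i = (d : ℤ) - 1 := fun i h1 h2 =>
    ⟨(k + i).toNat, by omega, by omega⟩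
  refine ⟨fun i h1 h2 => ?_, le_antisymm (fun g hg => ?_) ?_⟩
  · obtain ⟨d, hd, h⟩ := hidx i h1 h2
    rw [h, D.yForm_eq_zForm hd]
  · obtain ⟨t, ht, hmem⟩ := D.exists_sub_sum_mem_S hg hkl hlN hk0 hl0
    rw [← sub_add_cancel g (∑ i ∈ Finset.Ioc k l, t i • D.yForm ((i : ℤ) - 1))]
    refine add_mem (AddSubmonoid.subset_closure (Or.inl hmem)) (sum_mem fun i hi => ?_)
    rw [Finset.mem_Ioc] at hi
    apply SimplicialData.zsmul_mem_of_nonneg _ _ (ht i (Finset.mem_Ioc.2 hi))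
    apply AddSubmonoid.subset_closure
    right
    exact ⟨(i : ℤ) - k, by omega, by omega, by rw [hk]; congr 1; ring⟩
  · rw [AddSubmonoid.closure_le, Set.union_subset_iff]
    refine ⟨D.S_le_S', ?_⟩
    rintro _ ⟨i, h1, h2, rfl⟩
    obtain ⟨d, hd, h⟩ := hidx i h1 h2
    rw [h]
    exact D.yForm_mem_S' hd
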